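/- Let $\kappa$ be a supercompact cardinal and let $\mu>\kappa$ be a regular cardinal. Let $S\subseteq E^{\mu}_{<\kappa}=\{\alpha<\mu : \mathrm{cf}(\alpha)<\kappa\}$ be a stationary subset of $\mu$, and let $A$ be an algebra on $\mu$ (the set $\mu$ equipped with a family of finitary operations) with fewer than $\kappa$ operations. Then there is a set $X\subseteq\mu$ such that, if $B$ is the subalgebra of $A$ generated by $X$, then: - $\mathrm{o.t.}(B)=\mathrm{o.t.}(X)$, and this order type is a regular cardinal smaller than $\kappa$; - $S\cap B$ is stationary in $\sup(B)$, i.e. it meets every closed unbounded subset of $\sup(B)$. Moreover, if $\mu=\kappa^{+\omega+1}$, then $X$ can be chosen so that in addition $X\cap\kappa$ is an infinite cardinal $\delta$ (that is, the set $X\cap\kappa$ equals the initial ordinal $\delta$) and $\mathrm{o.t.}(B)=\delta^{+\omega+1}=(X\cap\kappa)^{+\omega+1}$. Here $\delta^{+\omega+1}$ is the successor cardinal of $\sup_{n<\omega}\delta^{+n}$. An uncountable cardinal $\kappa$ is supercompact if for every set $Y$ with $|Y|\ge\kappa$ there is a normal measure on $P_\kappa(Y)=\{x\subseteq Y: |x|<\kappa\}$,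 i.e. a $\kappa$-complete ultrafilter $U$ on $P_\kappa(Y)$ that is fine ($\{x : a\in x\}\in U$ for all $a\in Y$) and such that every function $f$ with $f(x)\in x$ for $U$-almost all $x$ is constant on a set in $U$. -/

import Mathlib

open scoped Ordinal Cardinal

universe u

/-- The set `P_κ(A)` of all subsets of `A` of cardinality less than `κ`. -/
def PKappa (κ : Cardinal.{u}) (A : Type u) : Type u :=
  {x : Set A // #x < κ}

/-- A normal measure on `P_κ(A)`: a `κ`-complete fine ultrafilter `U` on `P_κ(A)` such that every
function `f` with `f(x) ∈ x` for `U`-almost all `x` is constant on a set in `U`. -/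
structure IsNormalMeasure (κ : Cardinal.{u}) (A : Type u) (U : Ultrafilter (PKappa κ A)) :
    Prop where
  complete : CardinalInterFilter (U : Filter (PKappa κ A)) κ
  fine : ∀ a : A, ∀ᶠ x in (U : Filter (PKappa κ A)), a ∈ x.1
  normal : ∀ f : PKappa κ A → A, (∀ᶠ x in (U : Filter (PKappa κ A)), f x ∈ x.1) →
    ∃ a : A, ∀ᶠ x in (U : Filter (PKappa κ A)), f x = a

/-- An uncountable cardinal `κ` is supercompact if `P_κ(A)` carries a normal measure for every set
`A` with `|A| ≥ κ`. -/
structure IsSupercompact (κ : Cardinal.{u}) : Prop where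
  uncountable : ℵ₀ < κ
  exists_normalMeasure : ∀ A : Type u, κ ≤ #A →
    ∃ U : Ultrafilter (PKappa κ A), IsNormalMeasure κ A U

/-- `E^μ_{<κ}`, the set of ordinals below `μ` of cofinality less than `κ`. -/
def cofBelow (κ μ : Cardinal.{u}) : Set Ordinal.{u} :=
  {α | α < μ.ord ∧ α.cof < κ}

/-- A set `S` of ordinals is stationary in the ordinal `δ` if it meets every closed unbounded
subset of `δ`. -/
def StationaryIn (S : Set Ordinal.{u}) (δ : Ordinal.{u}) : Prop :=
  IsStationary {x : Set.Iio δ | (x : Ordinal.{u}) ∈ S}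

/-- The order type of a set of ordinals. It lives one universe higher than the ordinals in the set
because `X` may be a proper class relative to the universe `u`. -/
noncomputable def otp (X : Set Ordinal.{u}) : Ordinal.{u + 1} :=
  typeLT X

/-- The cardinal `κ^{+ω+1}`, the successor of the supremum of the cardinals `κ^{+n}`, `n < ω`. -/
noncomputable def succOmegaSucc (κ : Cardinal.{u}) : Cardinal.{u} :=
  Order.succ (⨆ n : ℕ, (Order.succ : Cardinal.{u} → Cardinal.{u})^[n] κ)

/-- The subalgebra of an algebra on the cardinal `μ` generated by a set `X` of elements of `μ`, as a
set of ordinals. An algebra on `μ` is a structure with universe `{α | α < μ}` for a language `L`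
without relation symbols; the function symbols of `L` name its finitary operations. -/
def generatedSubalgebra {μ : Cardinal.{u}} (L : FirstOrder.Language.{u, u})
    [L.Structure (Set.Iio μ.ord)] (X : Set Ordinal.{u}) : Set Ordinal.{u} :=
  Subtype.val ''
    (FirstOrder.Language.Substructure.closure L {x : Set.Iio μ.ord | (x : Ordinal.{u}) ∈ X} :
      Set (Set.Iio μ.ord))

-- Fix a normal measure on `P_κ(μ)`. Almost every `x` has all the required properties, so any such
-- `x` serves as `X`; it is closed under the operations, hence `B = X`. Normality does the work of
-- an elementary embedding: if functions `f_x` satisfy `f_x(c) ∈ x`, each value `f_x(c)` is constant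
-- almost everywhere, and these constants form one function on `μ`. A failure of regularity, or of
-- initiality of `|x ∩ s|`, for almost all `x` would thus produce a failure in `μ` itself.
--
-- Reflection (`stationary_reflection`): given sets `C_x` that are club in `sup x` and miss `S ∩ x`,
-- the ordinals closed under "almost every `C_x` meets `(a, b)`" form a club of `μ`. It contains
-- some `y ∈ S`. As `cf(y) < κ`, completeness makes almost every `C_x` unbounded in `y`, so `y ∈
-- C_x` for some `x` containing `y`, a contradiction.
--
-- For `μ = κ^{+ω+1}`, successor steps pass down to `x` (`mk_inter_eq_succ`), so `|x|` is computed
-- from `|x ∩ κ|`.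

universe v

open Filter Set

/-! ### Normality and completeness as rules for "almost every `x`". -/

namespace IsNormalMeasure

variable {κ : Cardinal.{u}} {Y : Type u} {U : Ultrafilter (PKappa κ Y)}

/-- Pressing down: a witness chosen inside `x` is a regressive function, so one witness works almost
everywhere. -/
theorem exists_eventually (hU : IsNormalMeasure κ Y U) {p : Y → PKappa κ Y → Prop}
    (h : ∀ᶠ x in (U : Filter (PKappa κ Y)), ∃ a ∈ x.1, p a x) :
    ∃ a, ∀ᶠ x in (U : Filter (PKappa κ Y)), p a x := by
  classical
  obtain ⟨x₀, a₀, -⟩ := h.exists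
  let f : PKappa κ Y → Y := fun x ↦ if hx : ∃ a ∈ x.1, p a x then hx.choose else a₀
  have hf : ∀ᶠ x in (U : Filter (PKappa κ Y)), f x ∈ x.1 ∧ p (f x) x := by
    filter_upwards [h] with x hx
    simp only [f, dif_pos hx]
    exact hx.choose_spec
  obtain ⟨a, ha⟩ := hU.normal f (hf.mono fun _ hx ↦ hx.1)
  exact ⟨a, by filter_upwards [hf, ha] with x hx hxa using hxa ▸ hx.2⟩

/-- Normal measures are closed under diagonal intersections. -/
theorem eventually_forall_mem (hU : IsNormalMeasure κ Y U) {p : Y → PKappa κ Y → Prop}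
    (h : ∀ a, ∀ᶠ x in (U : Filter (PKappa κ Y)), p a x) :
    ∀ᶠ x in (U : Filter (PKappa κ Y)), ∀ a ∈ x.1, p a x := by
  by_contra hn
  rw [← Ultrafilter.eventually_not] at hn
  obtain ⟨a, ha⟩ := hU.exists_eventually (p := fun a x ↦ ¬ p a x) (by simpa using hn)
  obtain ⟨x, hx, hx'⟩ := (ha.and (h a)).exists
  exact hx hx'

theorem eventually_forall (hU : IsNormalMeasure κ Y U) {ι : Type u} (hι : #ι < κ)
    {p : ι → PKappa κ Y → Prop} (h : ∀ i, ∀ᶠ x in (U : Filter (PKappa κ Y)), p i x) :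
    ∀ᶠ x in (U : Filter (PKappa κ Y)), ∀ i, p i x := by
  have := hU.complete
  have e : {x | ∀ i, p i x} = ⋂ i, {x | p i x} := by ext; simp
  rw [Filter.Eventually, e]
  exact (cardinal_iInter_mem (α := PKappa κ Y) hι).2 h

theorem eventually_subset (hU : IsNormalMeasure κ Y U) {s : Set Y} (hs : #s < κ) :
    ∀ᶠ x in (U : Filter (PKappa κ Y)), s ⊆ x.1 :=
  (hU.eventually_forall (ι := s) hs fun i ↦ hU.fine i).mono fun _ hx a ha ↦ hx ⟨a, ha⟩

theorem aleph0_le_mk_inter (hU : IsNormalMeasure κ Y U) (hκ : ℵ₀ < κ) {s : Set Y}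
    (hs : ℵ₀ ≤ #s) : ∀ᶠ x in (U : Filter (PKappa κ Y)), ℵ₀ ≤ #(x.1 ∩ s : Set Y) := by
  obtain ⟨t, hts, ht⟩ := Cardinal.le_mk_iff_exists_subset.1 hs
  filter_upwards [hU.eventually_subset (s := t) (ht ▸ hκ)] with x hx
  rw [← ht]
  exact Cardinal.mk_le_mk_of_subset (subset_inter hx hts)

theorem eventually_closed (hU : IsNormalMeasure κ Y U) {n : ℕ} (f : (Fin n → Y) → Y) :
    ∀ᶠ x in (U : Filter (PKappa κ Y)), ∀ v : Fin n → Y, (∀ i, v i ∈ x.1) → f v ∈ x.1 := by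
  by_contra hn
  rw [← Ultrafilter.eventually_not] at hn
  push Not at hn
  obtain ⟨v, hv⟩ := hn.choice
  -- Each coordinate of a counterexample tuple is regressive, so almost every tuple equals the fixed
  -- `c`; but `f c ∈ x` by fineness.
  choose c hc using fun i ↦ hU.normal (fun x ↦ v x i) (hv.mono fun x hx ↦ hx.1 i)
  obtain ⟨x, ⟨-, hx⟩, hxc, hxf⟩ := (hv.and ((eventually_all.2 hc).and (hU.fine (f c)))).exists
  exact hx (funext hxc ▸ hxf)

theorem eventually_closed_two (hU : IsNormalMeasure κ Y U) (f : Y → Y → Y) :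
    ∀ᶠ x in (U : Filter (PKappa κ Y)), ∀ a ∈ x.1, ∀ b ∈ x.1, f a b ∈ x.1 :=
  hU.eventually_forall_mem fun a ↦ hU.eventually_forall_mem fun b ↦ hU.fine (f a b)

variable [LinearOrder Y]

/-- If `s` is an initial ordinal, then so is `x ∩ s` for almost all `x`. -/
theorem mk_inter_Iio_lt (hU : IsNormalMeasure κ Y U) {s : Set Y}
    (hs : ∀ a ∈ s, #(Iio a) < #s) :
    ∀ᶠ x in (U : Filter (PKappa κ Y)), ∀ a ∈ x.1, a ∈ s →
      #(x.1 ∩ Iio a : Set Y) < #(x.1 ∩ s : Set Y) := by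
  classical
  refine hU.eventually_forall_mem fun a ↦ ?_
  by_cases ha : a ∈ s
  swap
  · simp [ha]
  by_contra hn
  rw [← Ultrafilter.eventually_not] at hn
  have key : ∀ᶠ x in (U : Filter (PKappa κ Y)), ∃ f : Y → Y,
      MapsTo f (x.1 ∩ s) (x.1 ∩ Iio a) ∧ InjOn f (x.1 ∩ s) := by
    filter_upwards [hn] with x hx
    obtain ⟨g⟩ : #(x.1 ∩ s : Set Y) ≤ #(x.1 ∩ Iio a : Set Y) := by simpa [ha] using hx
    refine ⟨fun c ↦ if h : c ∈ x.1 ∩ s then g ⟨c, h⟩ else a, fun c hc ↦ ?_, ?_⟩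
    · simp only [dif_pos hc]
      exact (g ⟨c, hc⟩).2
    · intro c hc d hd h
      simp only [dif_pos hc, dif_pos hd] at h
      simpa using g.injective (Subtype.ext h)
  obtain ⟨f, hn⟩ := key.choice
  -- The injections `f x` stabilise pointwise to an injection `F` of all of `s` into `Iio a`.
  have hF : ∀ c : s, ∃ d, ∀ᶠ x in (U : Filter (PKappa κ Y)), f x c = d := fun c ↦
    hU.normal (fun x ↦ f x c) <| by
      filter_upwards [hn, hU.fine c] with x hx hc using (hx.1 ⟨hc, c.2⟩).1
  choose F hF using hF
  have hFa : ∀ c, F c ∈ Iio a := fun c ↦ by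
    obtain ⟨x, hx, hc, h⟩ := (hn.and ((hU.fine (c : Y)).and (hF c))).exists
    exact h ▸ (hx.1 ⟨hc, c.2⟩).2
  refine (hs a ha).not_ge (Cardinal.mk_le_of_injective (f := fun c ↦ ⟨F c, hFa c⟩) ?_)
  intro c d hcd
  obtain ⟨x, hx, hc, hd, h, h'⟩ := (hn.and ((hU.fine (c : Y)).and ((hU.fine (d : Y)).and
    ((hF c).and (hF d))))).exists
  exact Subtype.ext (hx.2 ⟨hc, c.2⟩ ⟨hd, d.2⟩ (by rw [h, h']; simpa using hcd))

/-- If no `a ∈ s` has more predecessors than `d`, then the same holds inside almost every `x`. -/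
theorem mk_inter_Iio_le (hU : IsNormalMeasure κ Y U) {s : Set Y} {d : Y}
    (hs : ∀ a ∈ s, #(Iio a) ≤ #(Iio d)) :
    ∀ᶠ x in (U : Filter (PKappa κ Y)), ∀ a ∈ x.1, a ∈ s →
      #(x.1 ∩ Iio a : Set Y) ≤ #(x.1 ∩ Iio d : Set Y) := by
  classical
  have key : ∀ a : Y, ∃ f : Y → Y, a ∈ s → MapsTo f (Iio a) (Iio d) ∧ InjOn f (Iio a) := by
    intro a
    by_cases ha : a ∈ s
    · obtain ⟨g⟩ := hs a ha
      refine ⟨fun c ↦ if h : c ∈ Iio a then g ⟨c, h⟩ else a, fun _ ↦ ⟨fun c hc ↦ ?_, ?_⟩⟩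
      · simp only [dif_pos hc]
        exact (g ⟨c, hc⟩).2
      · intro c hc d hd h
        simp only [dif_pos hc, dif_pos hd] at h
        simpa using g.injective (Subtype.ext h)
    · exact ⟨id, fun h ↦ absurd h ha⟩
  choose f hf using key
  -- Closure of `x` under `(a, c) ↦ f a c` makes the fixed injections restrict to `x`.
  filter_upwards [hU.eventually_closed_two f] with x hx a hax has
  obtain ⟨hm, hi⟩ := hf a has
  refine Cardinal.mk_le_of_injective
    (f := fun c : (x.1 ∩ Iio a : Set Y) ↦ (⟨f a c, hx a hax c c.2.1, hm c.2.2⟩ :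
      (x.1 ∩ Iio d : Set Y))) ?_
  intro c c' h
  exact Subtype.ext (hi c.2.2 c'.2.2 (congrArg Subtype.val h))

/-- If `Y` is a regular cardinal, then for almost every `x` no function from a proper initial segment
of `x` to `x` is cofinal in `x`. -/
theorem eventually_bounded (hU : IsNormalMeasure κ Y U) (hY : ∀ a : Y, #(Iio a) < Order.cof Y) :
    ∀ᶠ x in (U : Filter (PKappa κ Y)), ∀ a ∈ x.1, ∀ g : Y → Y,
      (∀ b ∈ x.1, b < a → g b ∈ x.1) → ∃ c ∈ x.1, ∀ b ∈ x.1, b < a → g b < c := by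
  refine hU.eventually_forall_mem fun a ↦ ?_
  by_contra hn
  rw [← Ultrafilter.eventually_not] at hn
  push Not at hn
  obtain ⟨g, hn⟩ := hn.choice
  have hG : ∀ b : Iio a, ∃ d, ∀ᶠ x in (U : Filter (PKappa κ Y)), g x b = d := fun b ↦
    hU.normal (fun x ↦ g x b) <| by
      filter_upwards [hn, hU.fine b] with x hx hb using hx.1 b hb b.2
  choose G hG using hG
  have hc : ¬ IsCofinal (range G) := fun h ↦
    (Order.cof_le h).not_gt (Cardinal.mk_range_le.trans_lt (hY a))
  obtain ⟨c, hc⟩ := not_isCofinal_iff.1 hc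
  -- `c` lies strictly above every stabilised value `G b`, yet pressing down yields one `b` with `c
  -- ≤ g x b` almost everywhere.
  obtain ⟨b, hb⟩ := hU.exists_eventually (p := fun b x ↦ b < a ∧ c ≤ g x b) <| by
    filter_upwards [hn, hU.fine c] with x hx hcx using hx.2 c hcx
  obtain ⟨-, hba, -⟩ := hb.exists
  obtain ⟨x, hx, hx'⟩ := (hb.and (hG ⟨b, hba⟩)).exists
  have := hc _ (mem_range_self ⟨b, hba⟩)
  simp_all
  order

end IsNormalMeasure

/-! ### Clubs and cardinalities of initial segments. -/

theorem IsClub.preimage_orderIso {α : Type u} {β : Type v} [LinearOrder α] [LinearOrder β]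
    {t : Set β} (ht : IsClub t) (e : α ≃o β) : IsClub (e ⁻¹' t) := by
  refine ⟨fun d hd hd₀ _ a ha ↦ ?_, fun a ↦ ?_⟩
  · exact ht.isLUB_mem (image_subset_iff.2 hd) (hd₀.image e) (e.isLUB_image'.2 ha)
  · obtain ⟨b, hb, hab⟩ := ht.isCofinal (e a)
    exact ⟨e.symm b, by simpa using hb, e.le_symm_apply.2 hab⟩

theorem IsStationary.preimage_orderIso {α : Type u} {β : Type v} [LinearOrder α] [LinearOrder β]
    {s : Set β} (hs : IsStationary s) (e : α ≃o β) : IsStationary (e ⁻¹' s) := by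
  intro t ht
  obtain ⟨b, hb, hbt⟩ := hs (ht.preimage_orderIso e.symm)
  exact ⟨e.symm b, by simpa using hb, hbt⟩

/-- The closure points of a relation form a club. -/
theorem isClub_closurePoints {Y : Type u} [LinearOrder Y] [WellFoundedLT Y]
    (hY : ℵ₀ < Order.cof Y) {r : Y → Y → Prop} (hr : ∀ a, ∃ b, a < b ∧ r a b)
    (hr' : ∀ a a' b, a ≤ a' → r a' b → r a b) :
    IsClub {y : Y | (∃ a, a < y) ∧ ∀ a < y, ∃ b < y, r a b} := by
  refine ⟨fun d hd hd₀ _ y hy ↦ ⟨?_, fun a ha ↦ ?_⟩, fun a ↦ ?_⟩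
  · obtain ⟨z, hz⟩ := hd₀
    obtain ⟨a, ha⟩ := (hd hz).1
    exact ⟨a, ha.trans_le (hy.1 hz)⟩
  · obtain ⟨z, hz, haz⟩ := (lt_isLUB_iff hy).1 ha
    obtain ⟨b, hb, hab⟩ := (hd hz).2 a haz
    exact ⟨b, hb.trans_le (hy.1 hz), hab⟩
  · choose h hlt hrh using hr
    have hb : BddAbove (range fun n ↦ h^[n] a) := .of_not_isCofinal fun hc ↦
      (Order.cof_le hc).not_gt
        ((Cardinal.mk_le_aleph0_iff.2 (countable_range _).to_subtype).trans_lt hY)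
    -- The supremum of the iterates of `h` is a closure point; uncountable cofinality keeps it in
    -- `Y`.
    obtain ⟨y, hy, hmin⟩ := WellFounded.has_min wellFounded_lt
      (upperBounds (range fun n ↦ h^[n] a)) hb
    have hstep : ∀ n, h^[n] a < y := fun n ↦ by
      refine (hlt _).trans_le (hy ⟨n + 1, ?_⟩)
      simp [Function.iterate_succ_apply']
    refine ⟨y, ⟨⟨a, hstep 0⟩, fun c hc ↦ ?_⟩, (hstep 0).le⟩
    have : c ∉ upperBounds (range fun n ↦ h^[n] a) := fun h' ↦ hmin c h' hc
    simp only [mem_upperBounds, forall_mem_range, not_forall, not_le] at this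
    obtain ⟨n, hn⟩ := this
    refine ⟨h^[n + 1] a, hstep _, hr' _ _ _ hn.le ?_⟩
    rw [Function.iterate_succ_apply']
    exact hrh _

theorem Cardinal.mk_Iio_inter_le {α : Type u} [LinearOrder α] {s t : Set α}
    (a : (s ∩ t : Set α)) : #(Iio a) ≤ #(s ∩ Iio (a : α) : Set α) := by
  refine Cardinal.mk_le_of_injective
    (f := fun c : Iio a ↦ (⟨c, c.1.2.1, c.2⟩ : (s ∩ Iio (a : α) : Set α))) fun c c' h ↦ ?_
  simpa [Subtype.ext_iff] using h

theorem Cardinal.exists_mk_Iio_eq {α : Type u} [LinearOrder α] [WellFoundedLT α]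
    {c : Cardinal.{u}} (h : c.ord < typeLT α) : ∃ a : α, #(Iio a) = c := by
  refine ⟨Ordinal.enum (α := α) (· < ·) ⟨c.ord, h⟩, ?_⟩
  have := Ordinal.card_typein (r := ((· < ·) : α → α → Prop)) (Ordinal.enum (α := α) (· < ·) ⟨c.ord, h⟩)
  rwa [Ordinal.typein_enum, Cardinal.card_ord, eq_comm] at this

theorem Cardinal.mk_le_succ_of_forall_mk_Iio_le {α : Type u} [LinearOrder α] [WellFoundedLT α]
    {c : Cardinal.{u}} (h : ∀ a : α, #(Iio a) ≤ c) : #α ≤ Order.succ c := by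
  by_contra! hc
  obtain ⟨a, ha⟩ := Cardinal.exists_mk_Iio_eq (α := α)
    ((Cardinal.ord_lt_ord.2 hc).trans_le (by rw [Cardinal.ord_le, Ordinal.card_type]))
  exact ((Order.lt_succ c).trans_eq ha.symm).not_ge (h a)

theorem Cardinal.ord_mk_eq_of_forall_mk_Iio_lt {α : Type u} [LinearOrder α] [WellFoundedLT α]
    (h : ∀ a : α, #(Iio a) < #α) : (#α).ord = typeLT α := by
  refine le_antisymm (by rw [Cardinal.ord_le, Ordinal.card_type]) (le_of_forall_lt fun o ho ↦ ?_)
  rw [Cardinal.lt_ord, ← Ordinal.typein_enum (· < ·) ho]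
  exact h _

/-! ### Regularity, reflection and cardinality of almost every `x`. -/

namespace IsNormalMeasure

variable {κ : Cardinal.{u}} {Y : Type u} {U : Ultrafilter (PKappa κ Y)} [LinearOrder Y]

theorem mk_inter_eq_succ (hU : IsNormalMeasure κ Y U) [WellFoundedLT Y] {s : Set Y}
    {d : Y} (hd : d ∈ s) (hsd : #s = Order.succ #(Iio d))
    (hs' : ∀ a ∈ s, #(Iio a) ≤ #(Iio d)) :
    ∀ᶠ x in (U : Filter (PKappa κ Y)), #(x.1 ∩ s : Set Y) = Order.succ #(x.1 ∩ Iio d : Set Y) := by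
  filter_upwards [hU.mk_inter_Iio_le hs', hU.fine d,
    hU.mk_inter_Iio_lt (s := s) fun a ha ↦ hsd ▸ Order.lt_succ_of_le (hs' a ha)] with x h1 hdx h2
  refine le_antisymm (Cardinal.mk_le_succ_of_forall_mk_Iio_le fun a ↦ ?_)
    (Order.succ_le_of_lt (h2 d hdx hd))
  exact (Cardinal.mk_Iio_inter_le a).trans (h1 a a.2.1 a.2.2)

theorem ord_mk_inter (hU : IsNormalMeasure κ Y U) [WellFoundedLT Y] {s : Set Y}
    (hs : ∀ a ∈ s, #(Iio a) < #s) :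
    ∀ᶠ x in (U : Filter (PKappa κ Y)),
      (#(x.1 ∩ s : Set Y)).ord = typeLT (x.1 ∩ s : Set Y) := by
  filter_upwards [hU.mk_inter_Iio_lt hs] with x h
  exact Cardinal.ord_mk_eq_of_forall_mk_Iio_lt fun a ↦
    (Cardinal.mk_Iio_inter_le a).trans_lt (h a a.2.1 a.2.2)

theorem eventually_isRegular (hU : IsNormalMeasure κ Y U) [WellFoundedLT Y]
    (hY : ∀ a : Y, #(Iio a) < Order.cof Y) (hκ : ℵ₀ < κ) (hY₀ : ℵ₀ ≤ #Y) :
    ∀ᶠ x in (U : Filter (PKappa κ Y)),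
      (#x.1).IsRegular ∧ (#x.1).ord = typeLT x.1 := by
  filter_upwards [hU.eventually_bounded hY, hU.ord_mk_inter (s := univ) fun a _ ↦
    (hY a).trans_le (by simpa using Order.cof_le_cardinalMk Y),
    hU.aleph0_le_mk_inter hκ (s := univ) (by simpa using hY₀)] with x h1 h2 h3
  rw [inter_univ] at h2 h3
  refine ⟨⟨h3, ?_⟩, h2⟩
  rw [h2, Ordinal.cof_type, Order.le_cof_iff]
  intro t ht
  classical
  by_contra! hlt
  -- A cofinal set smaller than `x` is enumerated by a proper initial segment of `x`, against
  -- `eventually_bounded`.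
  obtain ⟨a, ha⟩ := Cardinal.exists_mk_Iio_eq (h2 ▸ Cardinal.ord_lt_ord.2 hlt)
  obtain ⟨e⟩ := Cardinal.eq.1 ha
  obtain ⟨c, hc, hcg⟩ := h1 a a.2
    (fun b ↦ if h : ∃ h : b ∈ x.1, b < a then e ⟨⟨b, h.1⟩, h.2⟩ else a) fun b hb hba ↦ by
      simp only [dif_pos (show ∃ h : b ∈ x.1, b < a from ⟨hb, hba⟩)]
      exact (e _).1.2
  obtain ⟨z, hz, hcz⟩ := ht ⟨c, hc⟩
  have := hcg (e.symm ⟨z, hz⟩).1 (e.symm ⟨z, hz⟩).1.2 (e.symm ⟨z, hz⟩).2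
  rw [dif_pos ⟨(e.symm ⟨z, hz⟩).1.2, (e.symm ⟨z, hz⟩).2⟩] at this
  simp only [Subtype.coe_eta, Equiv.apply_symm_apply] at this
  exact this.not_ge hcz

/-- Stationary sets of points of cofinality less than `κ` reflect to almost every `x`. -/
theorem stationary_reflection (hU : IsNormalMeasure κ Y U) [WellFoundedLT Y]
    (hY : ℵ₀ < Order.cof Y) {S : Set Y} (hS : IsStationary S) (hSκ : ∀ y ∈ S, Order.cof (Iio y) < κ) :
    ∀ᶠ x in (U : Filter (PKappa κ Y)), ∀ C : Set Y,
      (∀ a ∈ x.1, ∃ c ∈ C, a < c ∧ ∃ b ∈ x.1, c < b) →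
      (∀ y ∈ x.1, (∃ c ∈ C, c < y) → (∀ a < y, ∃ c ∈ C, a < c ∧ c < y) → y ∈ C) →
      ∃ y ∈ x.1, y ∈ S ∧ y ∈ C := by
  by_contra hn
  rw [← Ultrafilter.eventually_not] at hn
  push Not at hn
  obtain ⟨C, hC⟩ := hn.choice
  have hclub := isClub_closurePoints hY
    (r := fun a b ↦ ∀ᶠ x in (U : Filter (PKappa κ Y)), ∃ c ∈ C x, a < c ∧ c < b)
    (fun a ↦ by
      obtain ⟨b, hb⟩ := hU.exists_eventually (p := fun b x ↦ ∃ c ∈ C x, a < c ∧ c < b) <| by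
        filter_upwards [hC, hU.fine a] with x hxC hax
        obtain ⟨c, hc, hac, b, hb, hcb⟩ := hxC.1 a hax
        exact ⟨b, hb, c, hc, hac, hcb⟩
      obtain ⟨x, c, -, hac, hcb⟩ := hb.exists
      exact ⟨b, hac.trans hcb, hb⟩)
    (fun a a' b haa' h ↦ h.mono fun x ⟨c, hc, hac, hcb⟩ ↦ ⟨c, hc, haa'.trans_lt hac, hcb⟩)
  obtain ⟨y, hyS, ⟨a₀, ha₀⟩, hy⟩ := hS hclub
  obtain ⟨t, ht, htc⟩ := Order.exists_cof_eq (Iio y)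
  have hev : ∀ᶠ x in (U : Filter (PKappa κ Y)), ∀ a : t, ∃ c ∈ C x, a.1.1 < c ∧ c < y :=
    hU.eventually_forall (htc ▸ hSκ y hyS) fun a ↦ by
      obtain ⟨b, hb, hab⟩ := hy a.1 a.1.2
      exact hab.mono fun x ⟨c, hc, hac, hcb⟩ ↦ ⟨c, hc, hac, hcb.trans hb⟩
  obtain ⟨x, hxt, hyx, hxC⟩ := (hev.and ((hU.fine y).and hC)).exists
  have hlim : ∀ a < y, ∃ c ∈ C x, a < c ∧ c < y := fun a ha ↦ by
    obtain ⟨b, hb, hab⟩ := ht ⟨a, ha⟩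
    obtain ⟨c, hc, hbc, hcy⟩ := hxt ⟨b, hb⟩
    exact ⟨c, hc, lt_of_le_of_lt hab hbc, hcy⟩
  obtain ⟨c, hc, -, hcy⟩ := hlim a₀ ha₀
  exact hxC.2.2 y hyx hyS (hxC.2.1 y hyx ⟨c, hc, hcy⟩ hlim)

/-- If every `a < k` has fewer than `κ` predecessors, then almost every `x` meets `k` in an initial
segment. -/
theorem isLowerSet_inter_Iio (hU : IsNormalMeasure κ Y U) {k : Y} (hk : ∀ a < k, #(Iio a) < κ) :
    ∀ᶠ x in (U : Filter (PKappa κ Y)), IsLowerSet (x.1 ∩ Iio k) := by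
  have : ∀ᶠ x in (U : Filter (PKappa κ Y)), ∀ a ∈ x.1, a < k → Iio a ⊆ x.1 :=
    hU.eventually_forall_mem fun a ↦ by
      by_cases ha : a < k
      · exact (hU.eventually_subset (hk a ha)).mono fun _ h _ ↦ h
      · simp [ha]
  filter_upwards [this] with x hx a b hba ha
  obtain rfl | hba := hba.eq_or_lt
  · exact ha
  · exact ⟨hx a ha.1 ha.2 hba, hba.trans ha.2⟩

/-- If `Y` is `κ^{+ω+1}`, then almost every `x` has cardinality `δ^{+ω+1}` where `δ = |x ∩ κ|`. -/
theorem mk_eq_succOmegaSucc (hU : IsNormalMeasure κ Y U) [WellFoundedLT Y] (hκ : ℵ₀ < κ)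
    {k : ℕ → Y} {l : Y} (hk : ∀ n, #(Iio (k n)) = Order.succ^[n] κ)
    (hl : #(Iio l) = ⨆ n, Order.succ^[n] κ) (hkl : ∀ a, a < l ↔ ∃ n, a < k n)
    (hkk : ∀ n, k n < k (n + 1)) (hY : #Y = succOmegaSucc κ) (hYo : (#Y).ord = typeLT Y)
    (hko : ∀ n, ∀ a < k n, #(Iio a) < #(Iio (k n))) :
    ∀ᶠ x in (U : Filter (PKappa κ Y)),
      #x.1 = succOmegaSucc #(x.1 ∩ Iio (k 0) : Set Y) := by
  -- Countably many successor steps hold simultaneously by `κ`-completeness.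
  have h1 : ∀ᶠ x in (U : Filter (PKappa κ Y)), ∀ n : ULift.{u} ℕ,
      #(x.1 ∩ Iio (k (n.down + 1)) : Set Y) = Order.succ #(x.1 ∩ Iio (k n.down) : Set Y) := by
    refine hU.eventually_forall (by simpa using hκ) fun n ↦ ?_
    have hs : #(Iio (k (n.down + 1))) = Order.succ #(Iio (k n.down)) := by
      rw [hk, hk, Function.iterate_succ_apply']
    exact hU.mk_inter_eq_succ (hkk _) hs
      fun a ha ↦ Order.le_of_lt_succ (hs ▸ hko _ a ha)
  have h2 : ∀ᶠ x in (U : Filter (PKappa κ Y)),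
      #(x.1 ∩ univ : Set Y) = Order.succ #(x.1 ∩ Iio l : Set Y) := by
    have hs : #Y = Order.succ #(Iio l) := by rw [hY, hl]; rfl
    exact hU.mk_inter_eq_succ (mem_univ _) (by rw [Cardinal.mk_univ, hs])
      fun a _ ↦ Order.le_of_lt_succ (hs ▸ Cardinal.mk_Iio_lt a hYo)
  filter_upwards [h1, h2, hU.aleph0_le_mk_inter hκ (s := Iio (k 0)) (by simpa [hk] using hκ.le)]
    with x h1 h2 h3
  have h4 : ∀ n, #(x.1 ∩ Iio (k n) : Set Y) = Order.succ^[n] #(x.1 ∩ Iio (k 0) : Set Y) := by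
    intro n
    induction n with
    | zero => rfl
    | succ n ih => rw [h1 ⟨n⟩, ih, Function.iterate_succ_apply']
  rw [inter_univ] at h2
  rw [h2, succOmegaSucc]
  congr 1
  generalize #(x.1 ∩ Iio (k 0) : Set Y) = δ at h3 h4 ⊢
  have hb : BddAbove (range fun n : ℕ ↦ Order.succ^[n] δ) :=
    Cardinal.bddAbove_of_small
  apply le_antisymm
  · have hunion : (x.1 ∩ Iio l : Set Y) = ⋃ n, x.1 ∩ Iio (k n) := by
      ext a
      simp [hkl]
    rw [hunion]
    have := Cardinal.mk_iUnion_le_lift fun n ↦ x.1 ∩ Iio (k n)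
    simp only [h4, Cardinal.mk_eq_aleph0, Cardinal.lift_aleph0, Cardinal.lift_uzero] at this
    refine this.trans ?_
    exact Cardinal.mul_le_of_le (h3.trans (le_ciSup hb 0)) (h3.trans (le_ciSup hb 0)) le_rfl
  · refine ciSup_le' fun n ↦ ?_
    rw [← h4]
    exact Cardinal.mk_le_mk_of_subset fun a ha ↦ ⟨ha.1, (hkl a).2 ⟨n, ha.2⟩⟩

end IsNormalMeasure

/-! ### Transfer between `o.ToType` and sets of ordinals. -/

theorem lt_succOmegaSucc (κ : Cardinal.{u}) :
    ⨆ n : ℕ, Order.succ^[n] κ < succOmegaSucc κ := Order.lt_succ _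

theorem iterate_succ_lt_iSup (κ : Cardinal.{u}) (n : ℕ) :
    Order.succ^[n] κ < ⨆ n : ℕ, Order.succ^[n] κ := by
  refine (Order.lt_succ _).trans_le ?_
  rw [← Function.iterate_succ_apply' (f := Order.succ)]
  exact le_ciSup (f := fun n : ℕ ↦ Order.succ^[n] κ) Cardinal.bddAbove_of_small (n + 1)

theorem Ordinal.ToType.mk_Iio_eq {o : Ordinal.{u}} (y : o.ToType) :
    #(Iio y) = (ToType.mk.symm y : Ordinal.{u}).card :=
  (Ordinal.card_typein (r := ((· < ·) : o.ToType → o.ToType → Prop)) y).symm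

theorem Ordinal.lift_typeLT_eq_of_strictMonoOn {α : Type u} {β : Type v} [LinearOrder α]
    [WellFoundedLT α] [LinearOrder β] [WellFoundedLT β] {f : α → β} {s : Set α}
    (hf : StrictMonoOn f s) :
    Ordinal.lift.{u} (typeLT (f '' s)) = Ordinal.lift.{v} (typeLT s) :=
  (StrictMonoOn.orderIso f s hf).toRelIsoLT.ordinal_lift_type_eq.symm

/-- The ordinal below `o` that corresponds to an element of `o.ToType`. -/
noncomputable def Ordinal.ToType.val {o : Ordinal.{u}} (y : o.ToType) : Ordinal.{u} :=
  (ToType.mk.symm y : Set.Iio o)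

namespace Ordinal.ToType

variable {o : Ordinal.{u}}

theorem val_strictMono : StrictMono (val : o.ToType → Ordinal.{u}) :=
  fun _ _ h ↦ ToType.mk.symm.strictMono h

theorem val_lt (y : o.ToType) : y.val < o := (ToType.mk.symm y : Set.Iio o).2

theorem exists_val_eq {a : Ordinal.{u}} (h : a < o) : ∃ y : o.ToType, y.val = a :=
  ⟨ToType.mk ⟨a, h⟩, by simp [val]⟩

theorem otp_image_val (s : Set o.ToType) :
    otp (val '' s) = Ordinal.lift.{u + 1} (typeLT s) := by
  have := Ordinal.lift_typeLT_eq_of_strictMonoOn (val_strictMono.strictMonoOn s)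
  rwa [Ordinal.lift_id'.{u, u+1}] at this

theorem cof_Iio_val (y : o.ToType) : Order.cof (Iio y) = y.val.cof :=
  Order.cof_Iio y

end Ordinal.ToType

/-- A club of `sup x` pulls back to a set `C` unbounded in `x` and closed at points of `x`, which is
all that reflection uses. -/
theorem stationaryIn_sSup_image_val {o : Ordinal.{u}} {x : Set o.ToType} (hx₀ : x.Nonempty)
    (hx : ∀ a ∈ x, ∃ b ∈ x, a < b) {S : Set Ordinal.{u}}
    (hS : ∀ C : Set o.ToType,
      (∀ a ∈ x, ∃ c ∈ C, a < c ∧ ∃ b ∈ x, c < b) →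
      (∀ y ∈ x, (∃ c ∈ C, c < y) → (∀ a < y, ∃ c ∈ C, a < c ∧ c < y) → y ∈ C) →
      ∃ y ∈ x, y.val ∈ S ∧ y ∈ C) :
    StationaryIn (S ∩ Ordinal.ToType.val '' x) (sSup (Ordinal.ToType.val '' x)) := by
  intro D hD
  have hbdd : BddAbove (Ordinal.ToType.val '' x) := ⟨o, by
    rintro _ ⟨y, -, rfl⟩
    exact y.val_lt.le⟩
  have hlt : ∀ y ∈ x, y.val < sSup (Ordinal.ToType.val '' x) := fun y hy ↦ by
    obtain ⟨z, hz, hyz⟩ := hx y hy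
    exact (Ordinal.ToType.val_strictMono hyz).trans_le (le_csSup hbdd ⟨z, hz, rfl⟩)
  have key := hS
    {y | ∃ h : y.val < sSup (Ordinal.ToType.val '' x), (⟨y.val, h⟩ : Iio _) ∈ D} ?_ ?_
  · obtain ⟨y, hy, hyS, h, hyD⟩ := key
    exact ⟨⟨y.val, h⟩, ⟨hyS, y, hy, rfl⟩, hyD⟩
  · intro a ha
    obtain ⟨b, hb, hab⟩ := hx a ha
    obtain ⟨⟨c, hc⟩, hcD, hbc⟩ := hD.isCofinal ⟨b.val, hlt b hb⟩
    obtain ⟨_, ⟨d, hd, rfl⟩, hcd⟩ := exists_lt_of_lt_csSup (hx₀.image Ordinal.ToType.val) (mem_Iio.1 hc)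
    obtain ⟨c, rfl⟩ := Ordinal.ToType.exists_val_eq (hcd.trans d.val_lt)
    refine ⟨c, ⟨hc, hcD⟩, hab.trans_le ?_, d, hd, Ordinal.ToType.val_strictMono.lt_iff_lt.1 hcd⟩
    exact Ordinal.ToType.val_strictMono.le_iff_le.1 hbc
  · rintro y hy ⟨c, ⟨hc, hcD⟩, hcy⟩ hlim
    refine ⟨hlt y hy, hD.isLUB_mem (t := D ∩ Iio ⟨y.val, hlt y hy⟩) inter_subset_left
      ⟨⟨c.val, hc⟩, hcD, Ordinal.ToType.val_strictMono hcy⟩ ⟨fun z hz ↦ hz.2.le, fun z hz ↦ ?_⟩⟩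
    by_contra! hzy
    obtain ⟨a, ha⟩ := Ordinal.ToType.exists_val_eq ((show z.1 < y.val from hzy).trans y.val_lt)
    obtain ⟨c', ⟨hc', hcD'⟩, hac, hcy'⟩ := hlim a
      (Ordinal.ToType.val_strictMono.lt_iff_lt.1 (ha ▸ hzy))
    have h1 : c'.val ≤ z.1 := hz ⟨hcD', Ordinal.ToType.val_strictMono hcy'⟩
    exact (ha ▸ Ordinal.ToType.val_strictMono hac).not_ge h1

theorem generatedSubalgebra_eq_self {μ : Cardinal.{u}} (L : FirstOrder.Language.{u, u})
    [L.Structure (Set.Iio μ.ord)] {X : Set Ordinal.{u}} (hX : X ⊆ Iio μ.ord)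
    (h : ∀ (n : ℕ) (f : L.Functions n) (v : Fin n → Iio μ.ord), (∀ i, (v i : Ordinal.{u}) ∈ X) →
      ((FirstOrder.Language.Structure.funMap f v : Iio μ.ord) : Ordinal.{u}) ∈ X) :
    generatedSubalgebra (μ := μ) L X = X := by
  let T : L.Substructure (Iio μ.ord) := ⟨{x | (x : Ordinal.{u}) ∈ X}, fun f v hv ↦ h _ f v hv⟩
  have : FirstOrder.Language.Substructure.closure L {x : Set.Iio μ.ord | (x : Ordinal.{u}) ∈ X} = T :=
    FirstOrder.Language.Substructure.closure_eq T
  rw [generatedSubalgebra, this]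
  ext a
  exact ⟨fun ⟨b, hb, hab⟩ ↦ hab ▸ hb, fun ha ↦ ⟨⟨a, hX ha⟩, ha, rfl⟩⟩

theorem IsNormalMeasure.eventually_closed_funMap {κ μ : Cardinal.{u}}
    {U : Ultrafilter (PKappa κ μ.ord.ToType)} (hU : IsNormalMeasure κ μ.ord.ToType U)
    (L : FirstOrder.Language.{u, u}) [L.Structure (Set.Iio μ.ord)] (hL : L.card < κ) :
    ∀ᶠ x in (U : Filter (PKappa κ μ.ord.ToType)),
      ∀ (n : ℕ) (f : L.Functions n) (v : Fin n → Iio μ.ord),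
        (∀ i, (v i : Ordinal.{u}) ∈ Ordinal.ToType.val '' x.1) →
        ((FirstOrder.Language.Structure.funMap f v : Iio μ.ord) : Ordinal.{u}) ∈ Ordinal.ToType.val '' x.1 := by
  have hι : #(Σ n, L.Functions n) < κ := by
    refine lt_of_le_of_lt ?_ hL
    exact Cardinal.mk_le_of_injective (f := Sum.inl) Sum.inl_injective
  have := hU.eventually_forall hι fun f ↦ hU.eventually_closed fun v : Fin f.1 → μ.ord.ToType ↦
    Ordinal.ToType.mk (FirstOrder.Language.Structure.funMap f.2 fun i ↦ Ordinal.ToType.mk.symm (v i))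
  filter_upwards [this] with x hx n f v hv
  refine ⟨_, hx ⟨n, f⟩ (fun i ↦ Ordinal.ToType.mk (v i)) fun i ↦ ?_, by simp [Ordinal.ToType.val]⟩
  obtain ⟨y, hy, hyv⟩ := hv i
  convert hy
  rw [← OrderIso.eq_symm_apply]
  exact Subtype.ext hyv.symm

theorem otp_Iio (o : Ordinal.{u}) : otp (Iio o) = Ordinal.lift.{u + 1} o := Ordinal.type_lt_Iio o

theorem image_val_inter_Iio {o : Ordinal.{u}} (x : Set o.ToType) (k : o.ToType) :
    Ordinal.ToType.val '' x ∩ Iio k.val = Ordinal.ToType.val '' (x ∩ Iio k) := by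
  ext a
  constructor
  · rintro ⟨⟨y, hy, rfl⟩, h⟩
    exact ⟨y, ⟨hy, Ordinal.ToType.val_strictMono.lt_iff_lt.1 h⟩, rfl⟩
  · rintro ⟨y, ⟨hy, h⟩, rfl⟩
    exact ⟨⟨y, hy, rfl⟩, Ordinal.ToType.val_strictMono h⟩

theorem image_val_eq_Iio_of_isLowerSet {o : Ordinal.{u}} {s : Set o.ToType} (hs : IsLowerSet s) :
    ∃ ξ, Ordinal.ToType.val '' s = Iio ξ ∧ ξ = typeLT s := by
  have : IsLowerSet (Ordinal.ToType.val '' s) := by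
    rintro _ b hb ⟨y, hy, rfl⟩
    obtain ⟨z, rfl⟩ := Ordinal.ToType.exists_val_eq (lt_of_le_of_lt hb y.val_lt)
    exact ⟨z, hs (Ordinal.ToType.val_strictMono.le_iff_le.1 hb) hy, rfl⟩
  obtain h | ⟨ξ, h⟩ := this.eq_univ_or_Iio
  · obtain ⟨y, -, hy⟩ := h.ge (mem_univ o)
    exact absurd hy y.val_lt.ne
  · refine ⟨ξ, h, ?_⟩
    have h' := Ordinal.ToType.otp_image_val s
    rw [h, otp_Iio] at h'
    exact Ordinal.lift_inj.1 h'

/-! ### Choice of `X`. -/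

theorem mainTheorem2 (κ μ : Cardinal.{u}) (hκ : IsSupercompact κ) (hμ : μ.IsRegular) (hκμ : κ < μ)
    (S : Set Ordinal.{u}) (hS : S ⊆ cofBelow κ μ) (hstat : StationaryIn S μ.ord)
    (L : FirstOrder.Language.{u, u}) [L.IsAlgebraic] [L.Structure (Set.Iio μ.ord)]
    (hL : L.card < κ) :
    ∃ X B : Set Ordinal.{u}, X ⊆ Set.Iio μ.ord ∧ B = generatedSubalgebra (μ := μ) L X ∧
      otp B = otp X ∧
      (∃ ν : Cardinal.{u}, ν.IsRegular ∧ ν < κ ∧ otp X = Ordinal.lift.{u + 1} ν.ord) ∧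
      StationaryIn (S ∩ B) (sSup B) ∧
      (μ = succOmegaSucc κ → ∃ δ : Cardinal.{u}, ℵ₀ ≤ δ ∧ X ∩ Set.Iio κ.ord = Set.Iio δ.ord ∧
        otp B = Ordinal.lift.{u + 1} (succOmegaSucc δ).ord) := by
  have hκ₀ := hκ.uncountable
  have hcard : #μ.ord.ToType = μ := Cardinal.mk_ord_toType μ
  have hcof : Order.cof μ.ord.ToType = μ := by rw [Ordinal.cof_toType, hμ.cof_ord]
  have hord : (#μ.ord.ToType).ord = typeLT μ.ord.ToType := by rw [hcard, Ordinal.type_toType]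
  obtain ⟨U, hU⟩ := hκ.exists_normalMeasure μ.ord.ToType (hcard.symm ▸ hκμ.le)
  have hIio : ∀ a : μ.ord.ToType, #(Iio a) < Order.cof μ.ord.ToType := fun a ↦
    (Cardinal.mk_Iio_lt a hord).trans_eq (hcard.trans hcof.symm)
  have hinit : ∀ {c : Cardinal.{u}} {k : μ.ord.ToType}, k.val = c.ord → #(Iio k) = c := by
    intro c k h
    rw [Ordinal.ToType.mk_Iio_eq, show (Ordinal.ToType.mk.symm k : Ordinal.{u}) = c.ord from h,
      Cardinal.card_ord]
  have hlt : ∀ {c : Cardinal.{u}} {k a : μ.ord.ToType}, k.val = c.ord → (a < k ↔ #(Iio a) < c) := by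
    intro c k a h
    rw [Ordinal.ToType.mk_Iio_eq, ← Cardinal.lt_ord, ← h]
    exact Ordinal.ToType.val_strictMono.lt_iff_lt.symm
  obtain ⟨k, hk⟩ := Ordinal.ToType.exists_val_eq (Cardinal.ord_lt_ord.2 hκμ)
  have hS' : IsStationary {y : μ.ord.ToType | y.val ∈ S} :=
    hstat.preimage_orderIso Ordinal.ToType.mk.symm
  -- Keeping `μ = κ^{+ω+1}` as a premise inside the filter lets a single `x` serve both parts.
  have hext : ∀ᶠ x in (U : Filter (PKappa κ μ.ord.ToType)), μ = succOmegaSucc κ →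
      #x.1 = succOmegaSucc #(x.1 ∩ Iio k : Set μ.ord.ToType) := by
    by_cases hμκ : μ = succOmegaSucc κ
    swap
    · simp [hμκ]
    have hsup : (⨆ n : ℕ, Order.succ^[n] κ) < μ := hμκ ▸ lt_succOmegaSucc κ
    choose K hK using fun n : ℕ ↦ Ordinal.ToType.exists_val_eq
      (Cardinal.ord_lt_ord.2 ((iterate_succ_lt_iSup κ n).trans hsup))
    obtain ⟨l, hl⟩ := Ordinal.ToType.exists_val_eq (Cardinal.ord_lt_ord.2 hsup)
    have hK0 : K 0 = k := Ordinal.ToType.val_strictMono.injective ((hK 0).trans hk.symm)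
    filter_upwards [hU.mk_eq_succOmegaSucc hκ₀ (k := K) (l := l) (fun n ↦ hinit (hK n)) (hinit hl)
      (fun a ↦ by
        rw [hlt hl, lt_ciSup_iff Cardinal.bddAbove_of_small]
        exact exists_congr fun n ↦ (hlt (hK n)).symm)
      (fun n ↦ by
        rw [hlt (hK (n + 1)), hinit (hK n), Function.iterate_succ_apply']
        exact Order.lt_succ _)
      (hcard.trans hμκ) hord
      (fun n a ha ↦ by rwa [hinit (hK n), ← hlt (hK n)])] with x hx _
    rw [hx, hK0]
  obtain ⟨x, hreg, hstatx, hclosed, hext, hlow, hδ, hδ₀⟩ :=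
    ((hU.eventually_isRegular hIio hκ₀ (hcard.symm ▸ hμ.aleph0_le)).and
    ((hU.stationary_reflection (hcof.symm ▸ hκ₀.trans hκμ) hS' fun y hy ↦
      (Ordinal.ToType.cof_Iio_val y).trans_lt (hS hy).2).and
    ((hU.eventually_closed_funMap L hL).and
    (hext.and
    ((hU.isLowerSet_inter_Iio (k := k) fun a ha ↦ (hlt hk).1 ha).and
    ((hU.ord_mk_inter (s := Iio k) fun a ha ↦ by rw [hinit hk]; exact (hlt hk).1 ha).and
    (hU.aleph0_le_mk_inter hκ₀ (s := Iio k) (by rw [hinit hk]; exact hκ₀.le)))))))).exists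
  have hX : Ordinal.ToType.val '' x.1 ⊆ Iio μ.ord := by
    rintro _ ⟨y, -, rfl⟩
    exact y.val_lt
  have hotp : otp (Ordinal.ToType.val '' x.1) = Ordinal.lift.{u + 1} (#x.1).ord := by
    rw [Ordinal.ToType.otp_image_val, hreg.2]
  refine ⟨_, _, hX, (generatedSubalgebra_eq_self L hX hclosed).symm, rfl,
    ⟨#x.1, hreg.1, x.2, hotp⟩, ?_, fun hμκ ↦
      ⟨#(x.1 ∩ Iio k : Set μ.ord.ToType), hδ₀, ?_, by rw [hotp, ← hext hμκ]⟩⟩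
  · have hne : Nonempty x.1 := Cardinal.mk_ne_zero_iff.1 hreg.1.ne_zero
    have hmax : NoMaxOrder x.1 := by
      rw [← Ordinal.isSuccPrelimit_type_lt_iff, ← hreg.2]
      exact (Cardinal.isSuccLimit_ord hreg.1.aleph0_le).isSuccPrelimit
    refine stationaryIn_sSup_image_val (nonempty_coe_sort.1 hne) (fun a ha ↦ ?_) hstatx
    obtain ⟨b, hb⟩ := exists_gt (⟨a, ha⟩ : x.1)
    exact ⟨b, b.2, hb⟩
  · rw [← hk, image_val_inter_Iio]
    -- `x ∩ κ` is an initial segment, hence an ordinal, and its order type is an initial ordinal by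
    -- `hδ`.
    obtain ⟨ξ, h, rfl⟩ := image_val_eq_Iio_of_isLowerSet hlow
    rw [h, hδ]
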